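/- Let $\mathbf{o},\mathbf{q}\in\mathbb{R}^D$ be a data vector and a query vector, $dis=\|\mathbf{o}-\mathbf{q}\|_2$, let $r>0$ be a distance threshold and $\epsilon_0>0$ a parameter. Let $P$ be a random orthogonal $D\times D$ matrix (distributed according to the normalized Haar measure on $O(D)$) and $\mathbf{y}=P\mathbf{o}-P\mathbf{q}$. ADSampling samples the coordinates $y_1,y_2,\dots$ of $\mathbf{y}$ one at a time. After having sampled $d$ coordinates it computes the approximate distance $dis'_d=\sqrt{D/d}\,\bigl(\sum_{i\le d}y_i^2\bigr)^{1/2}$. If $d<D$ and $dis'_d>(1+\epsilon_0/\sqrt d)\,r$, it stops with the answer "$dis>r$"; if $d<D$ and this inequality fails, it continues with the next coordinate; if $d=D$, it stops and compares the then exact distance $dis'_D=dis$ with $r$. Let $\hat D$ be the number of coordinates sampled when it stops. For every $\epsilon_1>0$ there is a constant $C>0$, depending only on $\epsilon_1$, such that the following holds for all $D$, all $\mathbf{o},\mathbf{q}\in\mathbb{R}^D$, all $r>0$ with $dis>r$ and all $\epsilon_0\ge\epsilon_1$: with $\alpha=(dis-r)/r$, the random variable $\hat D$ is integrable and $$\mathbb{E}[\hat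 D]\;\le\; C\,\min\Bigl(D,\ \max\bigl(1,\ \epsilon_0^2/\alpha^2\bigr)\Bigr).$$ In particular $\mathbb{E}[\hat D]=O(\min(D,\epsilon_0^2/\alpha^2))$ when $\alpha\le\epsilon_0$, and $\mathbb{E}[\hat D]=O(1)$ when $\alpha>\epsilon_0$. -/

import Mathlib

open MeasureTheory

/-- The group of orthogonal `D × D` real matrices is compact: it is closed, and all entries of an
orthogonal matrix lie in `[-1, 1]`. -/
theorem isCompact_orthogonalGroup (D : ℕ) :
    IsCompact (Matrix.orthogonalGroup (Fin D) ℝ : Set (Matrix (Fin D) (Fin D) ℝ)) := by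
  have hK : IsCompact {M : Matrix (Fin D) (Fin D) ℝ | ∀ i, M i ∈ {v : Fin D → ℝ |
      ∀ j, v j ∈ Set.Icc (-1 : ℝ) 1}} :=
    isCompact_pi_infinite fun _ => isCompact_pi_infinite fun _ => isCompact_Icc
  refine hK.of_isClosed_subset isClosed_unitary ?_
  intro M hM i j
  have h := entry_norm_bound_of_unitary hM i j
  rw [Real.norm_eq_abs] at h
  exact abs_le.mp h

instance orthogonalGroup_compactSpace (D : ℕ) :
    CompactSpace (Matrix.orthogonalGroup (Fin D) ℝ) :=
  isCompact_iff_compactSpace.mp (isCompact_orthogonalGroup D)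

instance orthogonalGroup_measurableSpace (D : ℕ) :
    MeasurableSpace (Matrix.orthogonalGroup (Fin D) ℝ) := borel _

instance orthogonalGroup_borelSpace (D : ℕ) :
    BorelSpace (Matrix.orthogonalGroup (Fin D) ℝ) := ⟨rfl⟩

/-- The law of a random orthogonal `D × D` matrix: the Haar measure of the compact group `O(D)`,
normalized to have total mass one. -/
noncomputable def randomOrthogonal (D : ℕ) : Measure (Matrix.orthogonalGroup (Fin D) ℝ) :=
  Measure.haarMeasure ⊤

/-- The randomly transformed vector `P x`. -/
noncomputable def transform {D : ℕ} (P : Matrix.orthogonalGroup (Fin D) ℝ)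
    (x : EuclideanSpace ℝ (Fin D)) : EuclideanSpace ℝ (Fin D) :=
  Matrix.toEuclideanLin (P : Matrix (Fin D) (Fin D) ℝ) x

/-- The approximate distance `dis' = √(D / d) * ‖y restricted to its first d coordinates‖`. -/
noncomputable def approxDist {D : ℕ} (y : EuclideanSpace ℝ (Fin D)) (d : ℕ) : ℝ :=
  √((D : ℝ) / d) * √(∑ i : Fin D with i.val < d, (y i) ^ 2)

/-- The hypothesis test with `d` sampled dimensions rejects the null hypothesis `dis ≤ r`. -/
def Rejects {D : ℕ} (ε₀ r : ℝ) (y : EuclideanSpace ℝ (Fin D)) (d : ℕ) : Prop :=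
  approxDist y d > (1 + ε₀ / √(d : ℝ)) * r

open Classical in
/-- The loop of ADSampling, entered with `d` dimensions already sampled; one more dimension is
sampled in each iteration. The result is the answer to the distance comparison (`none` for the
answer `0`, meaning `dis > r`, and `some dis'` for the answer `1`, meaning `dis ≤ r`, with the
distance) together with the number of dimensions sampled at termination. -/
noncomputable def adSamplingLoop {D : ℕ} (ε₀ r : ℝ) (o' q' : EuclideanSpace ℝ (Fin D)) (d : ℕ) :
    Option ℝ × ℕ :=
  if d < D then
    let y := o' - q'
    if Rejects ε₀ r y (d + 1) ∧ d + 1 < D then (none, d + 1)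
    else if ¬ Rejects ε₀ r y (d + 1) ∧ d + 1 < D then adSamplingLoop ε₀ r o' q' (d + 1)
    else (if approxDist y (d + 1) ≤ r then some (approxDist y (d + 1)) else none, d + 1)
  else (none, d)
termination_by D - d

/-- ADSampling on a transformed data vector `o'`, a transformed query vector `q'` and a distance
threshold `r`, with parameter `ε₀`. -/
noncomputable def adSampling {D : ℕ} (ε₀ r : ℝ) (o' q' : EuclideanSpace ℝ (Fin D)) :
    Option ℝ × ℕ :=
  adSamplingLoop ε₀ r o' q' 0

/-- The number of dimensions that ADSampling samples for the object `o`, the query `q` and the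
threshold `r`, when the random orthogonal matrix is `P`. -/
noncomputable def numSampled {D : ℕ} (ε₀ r : ℝ) (o q : EuclideanSpace ℝ (Fin D))
    (P : Matrix.orthogonalGroup (Fin D) ℝ) : ℕ :=
  (adSampling ε₀ r (transform P o) (transform P q)).2

/-! Sampling goes past coordinate `d` only if the test at `d` fails to reject, so the expected count
is at most `1 + ∑ P(no rejection at d)` (`integral_numSampled_le_sum`). No independence between
tests is needed.

For `d ≥ 4ε₀²/α²` the rejection threshold is at most `(1 + α/2) r`, while the true distance is `(1 +
α) r`. Failing to reject then forces the first `d` coordinates to carry less than their share of the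
norm by a factor `1 - s`, `s = α/(2(1+α))` (`not_rejects_le`). By `randomOrthogonal_lower_tail` this
has probability at most `exp(-s²/4)^d`, and the geometric series sums to `O(1 + 1/α²)`. Since `ε₀ ≥
ε₁`, the term `1/α²` is absorbed into `ε₀²/α²`.

The tail bound comes from Gaussians: its event is a cone, so a rotated fixed vector may be replaced
by a Gaussian one (`randomOrthogonal_cone_mul_lintegral`), and a Chernoff bound reduces to a product
of one-dimensional Gaussian integrals. -/

/-! ### Haar measure on the orthogonal group and its action on spheres -/

instance randomOrthogonal_isHaarMeasure (D : ℕ) : (randomOrthogonal D).IsHaarMeasure := by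
  unfold randomOrthogonal; infer_instance

instance randomOrthogonal_isProbabilityMeasure (D : ℕ) :
    IsProbabilityMeasure (randomOrthogonal D) :=
  ⟨(Measure.haarMeasure_self
    (K₀ := (⊤ : TopologicalSpace.PositiveCompacts (Matrix.orthogonalGroup (Fin D) ℝ))))⟩

instance orthogonalGroup_secondCountableTopology (D : ℕ) :
    SecondCountableTopology (Matrix.orthogonalGroup (Fin D) ℝ) := by
  have : SecondCountableTopology (Matrix (Fin D) (Fin D) ℝ) :=
    inferInstanceAs (SecondCountableTopology (Fin D → Fin D → ℝ))
  exact inferInstanceAs (SecondCountableTopology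
    ((Matrix.orthogonalGroup (Fin D) ℝ : Set (Matrix (Fin D) (Fin D) ℝ))))

/-- Compact groups are unimodular: the right translate is still left invariant, hence a multiple of
Haar measure, and total mass one fixes the factor. -/
theorem map_mul_right_randomOrthogonal {D : ℕ} (Q : Matrix.orthogonalGroup (Fin D) ℝ) :
    (randomOrthogonal D).map (· * Q) = randomOrthogonal D := by
  have : IsProbabilityMeasure ((randomOrthogonal D).map (· * Q)) :=
    Measure.isProbabilityMeasure_map (by fun_prop)
  have h := Measure.isMulInvariant_eq_smul_of_compactSpace
    ((randomOrthogonal D).map (· * Q)) (randomOrthogonal D)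
  have h1 := congrArg (fun m => m Set.univ) h
  simp only [measure_univ, Measure.smul_apply, ENNReal.smul_def, smul_eq_mul, mul_one] at h1
  rw [h]
  ext s
  simp [ENNReal.smul_def, ← h1]

theorem transform_mul {D : ℕ} (P Q : Matrix.orthogonalGroup (Fin D) ℝ)
    (x : EuclideanSpace ℝ (Fin D)) : transform (P * Q) x = transform P (transform Q x) := by
  simp [transform, Matrix.toLpLin_apply]

theorem transform_sub {D : ℕ} (P : Matrix.orthogonalGroup (Fin D) ℝ)
    (x y : EuclideanSpace ℝ (Fin D)) : transform P (x - y) = transform P x - transform P y := by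
  simp [transform]

theorem transform_smul {D : ℕ} (P : Matrix.orthogonalGroup (Fin D) ℝ) (c : ℝ)
    (x : EuclideanSpace ℝ (Fin D)) : transform P (c • x) = c • transform P x := by
  simp [transform]

theorem norm_transform {D : ℕ} (P : Matrix.orthogonalGroup (Fin D) ℝ)
    (x : EuclideanSpace ℝ (Fin D)) : ‖transform P x‖ = ‖x‖ := by
  have h : (P : Matrix (Fin D) (Fin D) ℝ).transpose * (P : Matrix (Fin D) (Fin D) ℝ) = 1 :=
    (Matrix.mem_orthogonalGroup_iff' (Fin D) ℝ).mp P.2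
  have key : ‖transform P x‖ ^ 2 = ‖x‖ ^ 2 := by
    rw [EuclideanSpace.real_norm_sq_eq, EuclideanSpace.real_norm_sq_eq]
    simp only [transform, Matrix.toLpLin_apply, sq]
    change (P.1.mulVec x.ofLp) ⬝ᵥ (P.1.mulVec x.ofLp) = x.ofLp ⬝ᵥ x.ofLp
    rw [Matrix.dotProduct_mulVec, Matrix.vecMul_mulVec, h, Matrix.vecMul_one]
  exact (sq_eq_sq₀ (norm_nonneg _) (norm_nonneg _)).mp key

/-- The linear isometry of Euclidean space given by an orthogonal matrix. -/
noncomputable def transformIsometry {D : ℕ} (P : Matrix.orthogonalGroup (Fin D) ℝ) :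
    EuclideanSpace ℝ (Fin D) ≃ₗᵢ[ℝ] EuclideanSpace ℝ (Fin D) :=
  LinearIsometry.toLinearIsometryEquiv
    ⟨Matrix.toEuclideanLin (P : Matrix (Fin D) (Fin D) ℝ), norm_transform P⟩ rfl

theorem measurePreserving_transform {D : ℕ} (P : Matrix.orthogonalGroup (Fin D) ℝ) :
    MeasurePreserving (transform P) volume volume :=
  (transformIsometry P).measurePreserving

theorem continuous_transform (D : ℕ) :
    Continuous fun z : Matrix.orthogonalGroup (Fin D) ℝ × EuclideanSpace ℝ (Fin D) =>
      transform z.1 z.2 := by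
  simp only [transform, Matrix.toLpLin_apply]
  refine (PiLp.continuous_toLp 2 _).comp ?_
  exact Continuous.matrix_mulVec (continuous_subtype_val.comp continuous_fst)
    ((PiLp.continuous_ofLp 2 _).comp continuous_snd)

/-- The orthogonal group acts transitively on spheres. -/
theorem exists_transform_eq {D : ℕ} {x y : EuclideanSpace ℝ (Fin D)} (h : ‖x‖ = ‖y‖) :
    ∃ Q : Matrix.orthogonalGroup (Fin D) ℝ, transform Q x = y := by
  -- Vectors of equal norm are swapped by the reflection in the hyperplane orthogonal to their
  -- difference.
  let f := (Submodule.span ℝ {x - y})ᗮ.reflection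
  let b := EuclideanSpace.basisFun (Fin D) ℝ
  refine ⟨⟨_, f.toMatrix_mem_unitaryGroup b b⟩, ?_⟩
  have h1 : f x = y := Submodule.reflection_sub h
  rw [transform, Matrix.toEuclideanLin_eq_toLin_orthonormal, Matrix.toLin_toMatrix]
  exact h1

/-- The law of a random rotation of a nonzero vector, tested on a cone, does not depend on the
vector. -/
theorem randomOrthogonal_cone_eq {D : ℕ} {A : Set (EuclideanSpace ℝ (Fin D))}
    (hA : MeasurableSet A) (hcone : ∀ c : ℝ, 0 < c → ∀ x, c • x ∈ A ↔ x ∈ A)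
    {x y : EuclideanSpace ℝ (Fin D)} (hx : x ≠ 0) (hy : y ≠ 0) :
    randomOrthogonal D {P | transform P x ∈ A} = randomOrthogonal D {P | transform P y ∈ A} := by
  have hx' := norm_pos_iff.mpr hx
  have hy' := norm_pos_iff.mpr hy
  -- Right invariance absorbs `Q`; the cone property absorbs the scalar `‖x‖ / ‖y‖`.
  obtain ⟨Q, hQ⟩ := exists_transform_eq (x := x) (y := (‖x‖ / ‖y‖) • y) (by
    rw [norm_smul, Real.norm_of_nonneg (by positivity)]; field_simp)
  have hmeas : MeasurableSet {P | transform P x ∈ A} :=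
    ((continuous_transform D).comp (by fun_prop : Continuous fun P => (P, x))).measurable hA
  conv_lhs => rw [← map_mul_right_randomOrthogonal Q]
  rw [Measure.map_apply (by fun_prop) hmeas]
  congr 1
  ext P
  simp only [Set.preimage_ofPred_eq, Set.mem_ofPred_eq, transform_mul, hQ, transform_smul]
  exact hcone _ (by positivity) _

/-! ### Gaussian integrals and the Chernoff bound for random rotations -/

theorem integrable_exp_neg_sum_mul_sq {ι : Type*} [Fintype ι] {b : ι → ℝ} (hb : ∀ i, 0 < b i) :
    Integrable fun x : EuclideanSpace ℝ ι => Real.exp (-∑ i, b i * x i ^ 2) := by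
  rw [← (PiLp.volume_preserving_toLp ι).integrable_comp_emb
    (MeasurableEquiv.toLp 2 _).measurableEmbedding]
  simp only [Function.comp_def, ← Finset.sum_neg_distrib, Real.exp_sum, ← neg_mul]
  exact Integrable.fintype_prod (f := fun i (v : ℝ) => Real.exp (-b i * v ^ 2))
    fun i => integrable_exp_neg_mul_sq (hb i)

theorem integral_exp_neg_sum_mul_sq {ι : Type*} [Fintype ι] (b : ι → ℝ) :
    ∫ x : EuclideanSpace ℝ ι, Real.exp (-∑ i, b i * x i ^ 2) = ∏ i, √(Real.pi / b i) := by
  rw [← (PiLp.volume_preserving_toLp ι).integral_comp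
    (MeasurableEquiv.toLp 2 _).measurableEmbedding]
  simp only [← Finset.sum_neg_distrib, Real.exp_sum, ← neg_mul]
  rw [integral_fintype_prod_volume_eq_prod (f := fun i (v : ℝ) => Real.exp (-b i * v ^ 2))]
  simp only [integral_gaussian]

/-- The probability that a randomly rotated vector lies in a cone is the normalized Gaussian mass
of the cone. -/
theorem randomOrthogonal_cone_mul_lintegral {D : ℕ} {A : Set (EuclideanSpace ℝ (Fin D))}
    (hA : MeasurableSet A) (hcone : ∀ c : ℝ, 0 < c → ∀ x, c • x ∈ A ↔ x ∈ A)
    {x : EuclideanSpace ℝ (Fin D)} (hx : x ≠ 0) :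
    randomOrthogonal D {P | transform P x ∈ A} *
        ∫⁻ v : EuclideanSpace ℝ (Fin D), ENNReal.ofReal (Real.exp (-‖v‖ ^ 2)) =
      ∫⁻ v in A, ENNReal.ofReal (Real.exp (-‖v‖ ^ 2)) := by
  have : Nontrivial (EuclideanSpace ℝ (Fin D)) := ⟨x, 0, hx⟩
  let W : EuclideanSpace ℝ (Fin D) → ENNReal := fun v => ENNReal.ofReal (Real.exp (-‖v‖ ^ 2))
  have hW : Measurable W := by fun_prop
  have hT := (continuous_transform D).measurable
  -- Tonelli for `F`: for fixed `P`, rotations preserve volume; for fixed `v ≠ 0`, the weight is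
  -- rotation invariant and the probability of the cone does not depend on `v`.
  let F : Matrix.orthogonalGroup (Fin D) ℝ → EuclideanSpace ℝ (Fin D) → ENNReal :=
    fun P v => A.indicator W (transform P v)
  have hF : Measurable (Function.uncurry F) := (hW.indicator hA).comp hT
  have hswap := lintegral_lintegral_swap (μ := randomOrthogonal D)
    (ν := (volume : Measure (EuclideanSpace ℝ (Fin D)))) hF.aemeasurable
  have h1 (P) : ∫⁻ v, F P v = ∫⁻ v in A, W v := by
    rw [← lintegral_indicator hA]
    exact (measurePreserving_transform P).lintegral_comp (hW.indicator hA)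
  have h2 : ∀ᵐ v : EuclideanSpace ℝ (Fin D), ∫⁻ P, F P v ∂(randomOrthogonal D) =
      randomOrthogonal D {P | transform P x ∈ A} * W v := by
    filter_upwards [compl_mem_ae_iff.mpr (measure_singleton (0 : EuclideanSpace ℝ (Fin D)))]
      with v hv
    have hmeas : MeasurableSet {P | transform P v ∈ A} :=
      ((continuous_transform D).comp (by fun_prop : Continuous fun P => (P, v))).measurable hA
    have : ∀ P, F P v = {P | transform P v ∈ A}.indicator (fun _ => W v) P := fun P => by
      simp only [F, W, Set.indicator, norm_transform, Set.mem_ofPred_eq]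
    simp only [this]
    rw [lintegral_indicator_const hmeas, mul_comm,
      randomOrthogonal_cone_eq hA hcone hx (by simpa using hv)]
  simp only [h1] at hswap
  rw [lintegral_congr_ae h2, lintegral_const_mul _ hW] at hswap
  simpa using hswap.symm

/-- A Chernoff bound for a quadratic form in the coordinates of a randomly rotated vector. -/
theorem randomOrthogonal_quadratic_nonneg_le {D : ℕ} {a : Fin D → ℝ} (ha : ∀ i, a i < 1)
    {x : EuclideanSpace ℝ (Fin D)} (hx : x ≠ 0) :
    (randomOrthogonal D).real {P | 0 ≤ ∑ i, a i * transform P x i ^ 2} ≤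
      ∏ i, √(1 / (1 - a i)) := by
  let A : Set (EuclideanSpace ℝ (Fin D)) := {v | 0 ≤ ∑ i, a i * v i ^ 2}
  have hA : MeasurableSet A :=
    (isClosed_le continuous_const (by fun_prop)).measurableSet
  have hcone : ∀ c : ℝ, 0 < c → ∀ v, c • v ∈ A ↔ v ∈ A := fun c hc v => by
    have : ∑ i, a i * (c • v) i ^ 2 = c ^ 2 * ∑ i, a i * v i ^ 2 := by
      rw [Finset.mul_sum]
      exact Finset.sum_congr rfl fun i _ => by simp; ring
    simp only [A, Set.mem_ofPred_eq, this]
    exact mul_nonneg_iff_of_pos_left (by positivity)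
  have hnorm (v : EuclideanSpace ℝ (Fin D)) : -‖v‖ ^ 2 = -∑ i, (fun _ => (1 : ℝ)) i * v i ^ 2 := by
    simp [EuclideanSpace.real_norm_sq_eq]
  have hint : Integrable fun v : EuclideanSpace ℝ (Fin D) => Real.exp (-‖v‖ ^ 2) := by
    simp only [hnorm]
    exact integrable_exp_neg_sum_mul_sq fun _ => one_pos
  have hint' := integrable_exp_neg_sum_mul_sq (b := fun i => 1 - a i) fun i => by linarith [ha i]
  have key := congrArg ENNReal.toReal (randomOrthogonal_cone_mul_lintegral hA hcone hx)
  rw [ENNReal.toReal_mul, ← integral_eq_lintegral_of_nonneg_ae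
      (.of_forall fun _ => (Real.exp_pos _).le) hint.aestronglyMeasurable,
    ← integral_eq_lintegral_of_nonneg_ae
      (.of_forall fun _ => (Real.exp_pos _).le) hint.aestronglyMeasurable.restrict] at key
  have hle : ∫ v in A, Real.exp (-‖v‖ ^ 2) ≤ ∏ i, √(Real.pi / (1 - a i)) := by
    rw [← integral_exp_neg_sum_mul_sq]
    -- Exponential tilting: the extra factor `exp (∑ i, a i * v i ^ 2)` is at least one on `A`.
    calc ∫ v in A, Real.exp (-‖v‖ ^ 2) ≤ ∫ v in A, Real.exp (-∑ i, (1 - a i) * v i ^ 2) := by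
          refine setIntegral_mono_on hint.integrableOn hint'.integrableOn hA fun v hv => ?_
          have hv' : 0 ≤ ∑ i, a i * v i ^ 2 := hv
          simp only [hnorm, sub_mul, Finset.sum_sub_distrib, Real.exp_le_exp]
          linarith
      _ ≤ _ := setIntegral_le_integral hint' (.of_forall fun _ => (Real.exp_pos _).le)
  have htot : ∫ v : EuclideanSpace ℝ (Fin D), Real.exp (-‖v‖ ^ 2) = ∏ _i : Fin D, √Real.pi := by
    simp only [hnorm]
    rw [integral_exp_neg_sum_mul_sq]
    simp
  rw [← key, htot] at hle
  have hpos : 0 < ∏ _i : Fin D, √Real.pi := Finset.prod_pos fun _ _ => by positivity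
  refine le_of_mul_le_mul_right (hle.trans_eq ?_) hpos
  rw [← Finset.prod_mul_distrib]
  refine Finset.prod_congr rfl fun i _ => ?_
  rw [← Real.sqrt_mul (by have := ha i; have : 0 < 1 - a i := by linarith
                          positivity)]
  congr 1
  ring

/-! ### Lower tail for the first coordinates -/

/-- Truncates the series of `-log (1 - s)` after two terms. The quadratic term is essential: the
linear one cancels in the tail bound. -/
theorem one_sub_le_exp_neg_sub {s : ℝ} (h0 : 0 ≤ s) (h1 : s < 1) :
    1 - s ≤ Real.exp (-(s + s ^ 2 / 2)) := by
  rw [← Real.log_le_iff_le_exp (by linarith)]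
  have h := sum_le_hasSum (Finset.range 2) (fun n _ => by positivity)
    (Real.hasSum_pow_div_log_of_abs_lt_one (abs_lt.mpr ⟨by linarith, h1⟩))
  norm_num [Finset.sum_range_succ] at h
  linarith

/-- Lower tail of the squared norm of the first `d` coordinates of a randomly rotated vector. -/
theorem randomOrthogonal_lower_tail {D d : ℕ} (hd : d < D) {s : ℝ} (h0 : 0 ≤ s) (h1 : s < 1)
    {x : EuclideanSpace ℝ (Fin D)} (hx : x ≠ 0) :
    (randomOrthogonal D).real
        {P | D * ∑ i : Fin D with i.val < d, transform P x i ^ 2 ≤ d * (1 - s) * ‖x‖ ^ 2} ≤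
      Real.exp (-(s ^ 2 / 4)) ^ d := by
  have hdD : (d : ℝ) < D := by exact_mod_cast hd
  have hd0 : (0 : ℝ) ≤ d := by positivity
  have hs : 0 < 1 - s := by linarith
  obtain ⟨E, hE⟩ : ∃ E : ℝ, E = D - d * (1 - s) := ⟨_, rfl⟩
  have hden : 0 < E := by nlinarith
  -- The minimizer of the Chernoff bound over multiples of the quadratic form; it gives the simple
  -- values of `1 - a i` below.
  let c : ℝ := s / ((1 - s) * E)
  have hc : 0 ≤ c := by positivity
  let a : Fin D → ℝ := fun i => c * (d * (1 - s) - if i.val < d then (D : ℝ) else 0)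
  have ha1 (i : Fin D) (hi : i.val < d) : 1 - a i = 1 / (1 - s) := by
    simp only [a, hi, if_true, c]; field_simp; rw [hE]; ring
  have ha2 (i : Fin D) (hi : ¬ i.val < d) : 1 - a i = (D - d) / E := by
    simp only [a, hi, if_false, c]; field_simp; rw [hE]; ring
  have ha (i) : a i < 1 := by
    by_cases hi : i.val < d
    · have := ha1 i hi; have : 0 < 1 / (1 - s) := by positivity
      linarith
    · have := ha2 i hi
      have : 0 < (D - d) / E := div_pos (by linarith) hden
      linarith
  have hbound := randomOrthogonal_quadratic_nonneg_le ha hx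
  refine (measureReal_mono (fun P hP => ?_)).trans (hbound.trans ?_)
  · simp only [Set.mem_ofPred_eq] at hP ⊢
    have : ∑ i, a i * transform P x i ^ 2 = c * (d * (1 - s) * ‖x‖ ^ 2 -
        D * ∑ i : Fin D with i.val < d, transform P x i ^ 2) := by
      rw [← norm_transform P x, EuclideanSpace.real_norm_sq_eq, Finset.sum_filter, Finset.mul_sum,
        Finset.mul_sum, ← Finset.sum_sub_distrib, Finset.mul_sum]
      refine Finset.sum_congr rfl fun i _ => ?_
      simp only [a]
      split_ifs <;> ring
    rw [this]
    exact mul_nonneg hc (by linarith)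
  -- Over `d` factors of the first kind and `D - d` of the second, the exponents `-d s / 2` and `d s
  -- / 2` cancel, leaving `-d s² / 4`.
  · have hfac (i : Fin D) : √(1 / (1 - a i)) ≤ if i.val < d then
        Real.exp (-(s + s ^ 2 / 2) / 2) else Real.exp (d * s / (D - d) / 2) := by
      split_ifs with hi
      · rw [ha1 i hi, one_div_one_div, Real.sqrt_le_left (Real.exp_pos _).le, ← Real.exp_nat_mul]
        convert one_sub_le_exp_neg_sub h0 h1 using 2
        push_cast; ring
      · rw [ha2 i hi, Real.sqrt_le_left (Real.exp_pos _).le, ← Real.exp_nat_mul]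
        have hne : (D : ℝ) - d ≠ 0 := by linarith
        convert Real.add_one_le_exp (d * s / (D - d)) using 1
        · field_simp; rw [hE]; ring
        · congr 1; push_cast; ring
    refine (Finset.prod_le_prod (fun i _ => Real.sqrt_nonneg _) fun i _ => hfac i).trans_eq ?_
    have hcard : (Finset.univ.filter fun i : Fin D => i.val < d).card = d := by
      rw [Fin.card_filter_val_lt]; omega
    have hcard' : (Finset.univ.filter fun i : Fin D => ¬ i.val < d).card = D - d := by
      have := Finset.card_filter_add_card_filter_not (s := Finset.univ) fun i : Fin D => i.val < d
      simp only [Finset.card_univ, Fintype.card_fin] at this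
      omega
    rw [Finset.prod_ite, Finset.prod_const, Finset.prod_const, hcard, hcard', ← Real.exp_nat_mul,
      ← Real.exp_nat_mul, ← Real.exp_nat_mul, ← Real.exp_add, Nat.cast_sub hd.le]
    have hne : (D : ℝ) - d ≠ 0 := by linarith
    congr 1
    field_simp
    ring

/-! ### Running time of the loop as a sum of failed tests -/

open Classical in
theorem adSamplingLoop_snd_le {D : ℕ} (ε₀ r : ℝ) (o q : EuclideanSpace ℝ (Fin D)) (d : ℕ)
    (hd : d < D) :
    (adSamplingLoop ε₀ r o q d).2 ≤
      d + 1 + ∑ e ∈ Finset.Ico (d + 1) D, if Rejects ε₀ r (o - q) e then 0 else 1 := by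
  rw [adSamplingLoop]
  -- The sum stops before `D`, because the loop ends at `D` whatever the test says. It also counts
  -- failures after the loop has stopped, which only weakens the bound.
  simp only [hd, if_true]
  split_ifs with h1 h2
  all_goals try simp
  have ih := adSamplingLoop_snd_le ε₀ r o q (d + 1) h2.2
  rw [Finset.sum_eq_sum_Ico_succ_bot h2.2, if_neg h2.1]
  omega
termination_by D - d

theorem adSamplingLoop_snd_le_dim {D : ℕ} (ε₀ r : ℝ) (o q : EuclideanSpace ℝ (Fin D)) (d : ℕ)
    (hd : d ≤ D) : (adSamplingLoop ε₀ r o q d).2 ≤ D := by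
  rw [adSamplingLoop]
  split_ifs with h1
  · dsimp only
    split_ifs
    · exact h1
    · exact adSamplingLoop_snd_le_dim ε₀ r o q (d + 1) h1
    all_goals exact h1
  · exact hd
termination_by D - d

theorem measurableSet_rejects {D : ℕ} (ε₀ r : ℝ) (x : EuclideanSpace ℝ (Fin D)) (d : ℕ) :
    MeasurableSet {P : Matrix.orthogonalGroup (Fin D) ℝ | Rejects ε₀ r (transform P x) d} := by
  have h : Continuous fun P : Matrix.orthogonalGroup (Fin D) ℝ => transform P x :=
    (continuous_transform D).comp (by fun_prop : Continuous fun P => (P, x))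
  unfold Rejects approxDist
  exact (isOpen_lt continuous_const (by fun_prop)).measurableSet

theorem measurable_adSamplingLoop_snd {D : ℕ} (ε₀ r : ℝ) (o q : EuclideanSpace ℝ (Fin D))
    (d : ℕ) :
    Measurable fun P => (adSamplingLoop ε₀ r (transform P o) (transform P q) d).2 := by
  by_cases hd : d < D
  · have ih := measurable_adSamplingLoop_snd ε₀ r o q (d + 1)
    have hR : MeasurableSet {P : Matrix.orthogonalGroup (Fin D) ℝ |
        Rejects ε₀ r (transform P o - transform P q) (d + 1)} := by
      simpa only [transform_sub] using measurableSet_rejects ε₀ r (o - q) (d + 1)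
    have : (fun P => (adSamplingLoop ε₀ r (transform P o) (transform P q) d).2) =
        fun P => open Classical in
          if P ∈ {P : Matrix.orthogonalGroup (Fin D) ℝ |
              Rejects ε₀ r (transform P o - transform P q) (d + 1)} then d + 1
          else if d + 1 < D then (adSamplingLoop ε₀ r (transform P o) (transform P q) (d + 1)).2
          else d + 1 := by
      funext P
      rw [adSamplingLoop]
      simp only [hd, if_true, Set.mem_ofPred_eq]
      split_ifs <;> simp_all
    rw [this]
    refine Measurable.ite hR measurable_const ?_
    split_ifs
    exacts [ih, measurable_const]
  · have : (fun P => (adSamplingLoop ε₀ r (transform P o) (transform P q) d).2) = fun _ => d := by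
      funext P
      rw [adSamplingLoop]
      simp [hd]
    rw [this]
    exact measurable_const
termination_by D - d

theorem integrable_numSampled {D : ℕ} (ε₀ r : ℝ) (o q : EuclideanSpace ℝ (Fin D)) :
    Integrable (fun P => (numSampled ε₀ r o q P : ℝ)) (randomOrthogonal D) := by
  refine Integrable.of_bound (C := D)
    (measurable_from_top.comp (measurable_adSamplingLoop_snd ε₀ r o q 0)).aestronglyMeasurable
    (.of_forall fun P => ?_)
  rw [Real.norm_of_nonneg (by positivity)]
  exact_mod_cast adSamplingLoop_snd_le_dim ε₀ r _ _ 0 D.zero_le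

theorem integral_numSampled_le_dim {D : ℕ} (ε₀ r : ℝ) (o q : EuclideanSpace ℝ (Fin D)) :
    ∫ P, (numSampled ε₀ r o q P : ℝ) ∂(randomOrthogonal D) ≤ D := by
  refine (integral_mono (g := fun _ => (D : ℝ)) (integrable_numSampled ε₀ r o q)
    (integrable_const _) fun P => ?_).trans_eq (by simp)
  exact Nat.cast_le.mpr (adSamplingLoop_snd_le_dim ε₀ r _ _ 0 D.zero_le)

theorem integral_numSampled_le_sum {D : ℕ} (hD : 0 < D) (ε₀ r : ℝ)
    (o q : EuclideanSpace ℝ (Fin D)) :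
    ∫ P, (numSampled ε₀ r o q P : ℝ) ∂(randomOrthogonal D) ≤
      1 + ∑ d ∈ Finset.Ico 1 D,
        (randomOrthogonal D).real {P | ¬ Rejects ε₀ r (transform P (o - q)) d} := by
  have hmeas (d : ℕ) : MeasurableSet {P : Matrix.orthogonalGroup (Fin D) ℝ |
      ¬ Rejects ε₀ r (transform P (o - q)) d} := (measurableSet_rejects ε₀ r (o - q) d).compl
  have hint (d : ℕ) : Integrable ({P : Matrix.orthogonalGroup (Fin D) ℝ |
      ¬ Rejects ε₀ r (transform P (o - q)) d}.indicator fun _ => (1 : ℝ)) (randomOrthogonal D) :=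
    (integrable_const _).indicator (hmeas d)
  have hsum := integrable_finsetSum (Finset.Ico 1 D) fun d _ => hint d
  refine (integral_mono (integrable_numSampled ε₀ r o q) ((integrable_const 1).add hsum)
    fun P => ?_).trans_eq ?_
  · have h := adSamplingLoop_snd_le ε₀ r (transform P o) (transform P q) 0 hD
    rw [← transform_sub] at h
    have h' : (numSampled ε₀ r o q P : ℝ) ≤ _ := Nat.cast_le.mpr h
    push_cast at h'
    refine h'.trans_eq ?_
    simp only [Set.indicator, Set.mem_ofPred_eq, Pi.add_apply]
    congr 1
    refine Finset.sum_congr rfl fun d _ => ?_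
    split_ifs <;> rfl
  · simp only [Pi.add_apply]
    rw [integral_add (integrable_const 1) hsum, integral_finsetSum _ fun d _ => hint d]
    simp [integral_indicator_const, hmeas]

/-! ### Failed tests as tail events, and summation -/

theorem not_rejects_le {D d : ℕ} (hd : 1 ≤ d) {ε₀ r α : ℝ} (hr : 0 < r) (hα : 0 < α)
    (hlarge : 4 * ε₀ ^ 2 / α ^ 2 ≤ d) {x y : EuclideanSpace ℝ (Fin D)}
    (hx : ‖x‖ = (1 + α) * r) (h : ¬ Rejects ε₀ r y d) :
    D * ∑ i : Fin D with i.val < d, y i ^ 2 ≤ d * (1 - α / (2 * (1 + α))) * ‖x‖ ^ 2 := by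
  have hd0 : (0 : ℝ) < d := by exact_mod_cast hd
  have hsq : 2 * ε₀ / α ≤ √d := by
    refine Real.le_sqrt_of_sq_le (le_of_eq_of_le ?_ hlarge)
    ring
  have hsmall : ε₀ / √d ≤ α / 2 := by
    have : 0 < √(d : ℝ) := by positivity
    rw [div_le_iff₀ hα] at hsq
    rw [div_le_iff₀ this]
    linarith
  unfold Rejects approxDist at h
  have hS : 0 ≤ ∑ i : Fin D with i.val < d, y i ^ 2 := Finset.sum_nonneg fun _ _ => sq_nonneg _
  set S := ∑ i : Fin D with i.val < d, y i ^ 2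
  have h1 : √(D / d * S) ≤ (1 + α / 2) * r := by
    rw [Real.sqrt_mul (by positivity)]
    exact (not_lt.mp h).trans (by gcongr)
  rw [Real.sqrt_le_left (by positivity)] at h1
  -- The factor `1 - α / (2 * (1 + α))` is the ratio `(1 + α / 2) / (1 + α)` of threshold to
  -- distance. Its first power suffices, although its square would also hold.
  have h2 : ((1 + α / 2) * r) ^ 2 ≤ (1 - α / (2 * (1 + α))) * ‖x‖ ^ 2 := by
    rw [hx]
    have : (1 - α / (2 * (1 + α))) * ((1 + α) * r) ^ 2 = (1 + α / 2) * (1 + α) * r ^ 2 := by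
      field_simp; ring
    rw [this, mul_pow]
    gcongr
    nlinarith
  calc D * S = d * (D / d * S) := by field_simp
    _ ≤ d * ((1 - α / (2 * (1 + α))) * ‖x‖ ^ 2) :=
      mul_le_mul_of_nonneg_left (h1.trans h2) hd0.le
    _ = _ := by ring

theorem sum_range_exp_neg_pow_le {a : ℝ} (ha : 0 < a) (n : ℕ) :
    ∑ d ∈ Finset.range n, Real.exp (-a) ^ d ≤ 1 + 1 / a := by
  have h1 : Real.exp (-a) < 1 := Real.exp_lt_one_iff.mpr (by linarith)
  have h := (summable_geometric_of_lt_one (Real.exp_pos _).le h1).sum_le_tsum (Finset.range n)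
    fun _ _ => by positivity
  rw [tsum_geometric_of_lt_one (Real.exp_pos _).le h1] at h
  refine h.trans ?_
  have h2 : Real.exp (-a) * (1 + a) ≤ 1 := by
    calc Real.exp (-a) * (1 + a) ≤ Real.exp (-a) * Real.exp a := by
          gcongr; linarith [Real.add_one_le_exp a]
      _ = 1 := by rw [← Real.exp_add]; simp
  rw [inv_le_iff_one_le_mul₀ (by linarith)]
  have : (1 + 1 / a) * (1 - Real.exp (-a)) = (1 + a - Real.exp (-a) * (1 + a)) / a := by
    field_simp
    ring
  rw [this, le_div_iff₀ ha]
  linarith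

theorem integral_numSampled_le {D : ℕ} {o q : EuclideanSpace ℝ (Fin D)} {r ε₀ α : ℝ}
    (hr : 0 < r) (hα : 0 < α) (hdist : dist o q = (1 + α) * r) :
    ∫ P, (numSampled ε₀ r o q P : ℝ) ∂(randomOrthogonal D) ≤
      3 + 4 * (ε₀ ^ 2 / α ^ 2) + 16 * (1 + α) ^ 2 / α ^ 2 := by
  rw [dist_eq_norm] at hdist
  have hx : o - q ≠ 0 := norm_pos_iff.mp (by rw [hdist]; positivity)
  have hD : 0 < D := by
    rcases Nat.eq_zero_or_pos D with rfl | h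
    · exact absurd (Subsingleton.elim _ _) hx
    · exact h
  let s := α / (2 * (1 + α))
  have hs0 : 0 < s := by positivity
  have hs1 : s < 1 := by
    simp only [s]; rw [div_lt_one (by positivity)]; linarith
  let m := 4 * ε₀ ^ 2 / α ^ 2
  have hm : 0 ≤ m := by positivity
  have hterm (d : ℕ) (hd : d ∈ Finset.Ico 1 D) :
      (randomOrthogonal D).real {P | ¬ Rejects ε₀ r (transform P (o - q)) d} ≤
        -- Below `m` the slack `ε₀ / √d` may exceed `α / 2`, so only the trivial bound is used
        -- there.
        (if d < ⌈m⌉₊ then 1 else 0) + Real.exp (-(s ^ 2 / 4)) ^ d := by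
    rw [Finset.mem_Ico] at hd
    split_ifs with h
    · exact measureReal_le_one.trans (le_add_of_nonneg_right (by positivity))
    · rw [zero_add]
      refine (measureReal_mono fun P hP => ?_).trans
        (randomOrthogonal_lower_tail hd.2 hs0.le hs1 hx)
      exact not_rejects_le hd.1 hr hα (Nat.ceil_le.mp (not_lt.mp h)) hdist hP
  refine (integral_numSampled_le_sum hD ε₀ r o q).trans ?_
  have hsum := Finset.sum_le_sum hterm
  rw [Finset.sum_add_distrib] at hsum
  have hcount : ∑ d ∈ Finset.Ico 1 D, (if d < ⌈m⌉₊ then (1 : ℝ) else 0) ≤ m + 1 := by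
    rw [Finset.sum_boole]
    have : ((Finset.Ico 1 D).filter (· < ⌈m⌉₊)).card ≤ ⌈m⌉₊ := by
      refine (Finset.card_le_card (t := Finset.range ⌈m⌉₊) fun d hd => ?_).trans_eq
        (Finset.card_range _)
      exact Finset.mem_range.mpr (Finset.mem_filter.mp hd).2
    exact (Nat.cast_le.mpr this).trans (Nat.ceil_lt_add_one hm).le
  have hgeom : ∑ d ∈ Finset.Ico 1 D, Real.exp (-(s ^ 2 / 4)) ^ d ≤ 1 + 1 / (s ^ 2 / 4) := by
    refine (Finset.sum_le_sum_of_subset_of_nonneg (t := Finset.range D) (fun d hd => ?_)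
      fun _ _ _ => by positivity).trans (sum_range_exp_neg_pow_le (by positivity) D)
    exact Finset.mem_range.mpr (Finset.mem_Ico.mp hd).2
  have hs : 1 / (s ^ 2 / 4) = 16 * (1 + α) ^ 2 / α ^ 2 := by
    simp only [s]; field_simp; ring
  have hm' : m = 4 * (ε₀ ^ 2 / α ^ 2) := by simp only [m]; ring
  linarith

theorem lemma3p3 (ε₁ : ℝ) (hε₁ : 0 < ε₁) :
    ∃ C : ℝ, 0 < C ∧
      ∀ (D : ℕ) (o q : EuclideanSpace ℝ (Fin D)) (r ε₀ α : ℝ),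
        0 < r → r < dist o q → ε₁ ≤ ε₀ → α = (dist o q - r) / r →
          Integrable (fun P => (numSampled ε₀ r o q P : ℝ)) (randomOrthogonal D) ∧
          ∫ P, (numSampled ε₀ r o q P : ℝ) ∂(randomOrthogonal D)
            ≤ C * min (D : ℝ) (max 1 (ε₀ ^ 2 / α ^ 2)) := by
  -- From `3 + 4X + 32 + 32/α²` with `X = ε₀²/α²`: here `39 = 3 + 4 + 32`, and `32/α² ≤ (32/ε₁²) X`.
  refine ⟨39 + 32 / ε₁ ^ 2, by positivity, fun D o q r ε₀ α hr hlt hε hα => ?_⟩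
  refine ⟨integrable_numSampled ε₀ r o q, ?_⟩
  have hα0 : 0 < α := by rw [hα]; exact div_pos (by linarith) hr
  have hε0 : 0 < ε₀ := by linarith
  have hdist : dist o q = (1 + α) * r := by rw [hα]; field_simp; ring
  have hC : 0 ≤ 32 / ε₁ ^ 2 := by positivity
  rw [mul_min_of_nonneg _ _ (by positivity)]
  refine le_min ?_ ((integral_numSampled_le hr hα0 hdist).trans ?_)
  · have hDnn : (0 : ℝ) ≤ D := by positivity
    nlinarith [integral_numSampled_le_dim ε₀ r o q]
  · have h1 := le_max_left 1 (ε₀ ^ 2 / α ^ 2)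
    have h2 := le_max_right 1 (ε₀ ^ 2 / α ^ 2)
    have h3 : 16 * (1 + α) ^ 2 / α ^ 2 ≤ 32 + 32 * (1 / α ^ 2) := by
      rw [div_le_iff₀ (by positivity), add_mul, mul_assoc 32 (1 / α ^ 2),
        one_div_mul_cancel (by positivity)]
      -- This is `(1 + α)² ≤ 2 (1 + α²)`.
      nlinarith [sq_nonneg (α - 1)]
    have h4 : 32 * (1 / α ^ 2) ≤ 32 / ε₁ ^ 2 * (ε₀ ^ 2 / α ^ 2) := by
      have : 32 / ε₁ ^ 2 * (ε₀ ^ 2 / α ^ 2) = 32 * (ε₀ ^ 2 / ε₁ ^ 2 / α ^ 2) := by ring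
      rw [this]
      gcongr
      rw [one_le_div (by positivity)]
      gcongr
    nlinarith [mul_le_mul_of_nonneg_left h2 hC]
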